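/- Let $D$ be an integral domain with quotient field $K$. For nonzero $D$-submodules $A,B$ of $K$ put $(A:B)=\{x\in K: xB\subseteq A\}$ and $B^{-1}=(D:B)$. A semistar operation on $D$ is a map $E\mapsto E^\star$ from the set of nonzero $D$-submodules of $K$ to itself such that, for all $0\neq x\in K$ and all $E,F$: $(xE)^\star=xE^\star$; $E\subseteq F$ implies $E^\star\subseteq F^\star$; $E\subseteq E^\star$ and $(E^\star)^\star=E^\star$. The semistar operation $\star_f$ is defined by letting $E^{\star_f}$ be the union of the $F^\star$ with $F\subseteq E$ nonzero and finitely generated. The domain $D$ is a P$\star$MD if $(FF^{-1})^{\star_f}=D^{\star_f}$ for every nonzero finitely generated $D$-submodule $F$ of $K$. A quasi-$\star_f$-maximal ideal is a maximal element of the set of proper nonzero ideals $I$ of $D$ with $I=I^{\star_f}\cap D$; such an ideal is prime. A nonzero ideal $I$ is $\star_f$-idempotent if $I^{\star_f}=(I^2)^{\star_f}$. A prime ideal $P$ is branched if there is a $P$-primary ideal different from $P$. A prime $P\neq 0$ with $P=P^{\star_f}\cap D$ is $\star_f$-sharp if $\bigcap\{D_M : M \text{ quasi-}\star_f\text{-maximal},\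 M\nsupseteq P\}\nsubseteq D_P$ (an empty intersection being $K$). (1) Let $\star$ be a semistar operation on $D$, and assume that $D$ is a P$\star$MD such that $I$ is $\star_f$-idempotent whenever $I$ is a nonzero ideal of $D$ with $(D^\star:I)=D^\star$. Then each branched quasi-$\star_f$-maximal ideal of $D$ is $\star_f$-sharp. (2) Let $v$ be the operation $E^v=(E^{-1})^{-1}$ and $t=v_f$. Suppose that $D$ is a P$v$MD (that is, $(FF^{-1})^t=D$ for every nonzero finitely generated $D$-submodule $F$ of $K$) in which $I$ is $t$-idempotent (that is, $I^t=(I^2)^t$) whenever $I$ is a nonzero ideal of $D$ with $I^{-1}=D$. Then each branched maximal $t$-ideal $M$ of $D$ (that is, each branched maximal element of the set of proper nonzero ideals $I$ with $I^t=I$) is $t$-sharp, i.e. $\bigcap\{D_N : N \text{ a maximal } t\text{-ideal},\ N\nsupseteq M\}\nsubseteq D_M$. -/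

import Mathlib

open scoped Pointwise
open IsLocalization (coeSubmodule)

/-- A semistar operation on a domain `D` with quotient field `K`: a map `E ↦ E^⋆` on the nonzero
`D`-submodules of `K` with `(xE)^⋆ = xE^⋆` for `x ≠ 0`, monotone, extensive and idempotent.
It is recorded as a map on all `D`-submodules, where the value at the zero submodule, which plays
no role, is normalized to be zero (so each semistar operation corresponds to exactly one term). -/
structure SemistarOperation (D K : Type*) [CommRing D] [IsDomain D] [Field K] [Algebra D K]
    [IsFractionRing D K] where
  toFun : Submodule D K → Submodule D K
  map_bot' : toFun ⊥ = ⊥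
  map_smul' : ∀ (x : K) (E : Submodule D K), x ≠ 0 → toFun (x • E) = x • toFun E
  mono' : ∀ E F : Submodule D K, E ≤ F → toFun E ≤ toFun F
  le_self' : ∀ E : Submodule D K, E ≤ toFun E
  idem' : ∀ E : Submodule D K, toFun (toFun E) = toFun E

namespace SemistarOperation

variable {D K : Type*} [CommRing D] [IsDomain D] [Field K] [Algebra D K] [IsFractionRing D K]

instance : CoeFun (SemistarOperation D K) (fun _ => Submodule D K → Submodule D K) :=
  ⟨SemistarOperation.toFun⟩

/-- The underlying map of `⋆_f`: the union of the `F^⋆`, where `F` ranges over the finitely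
generated submodules of `E` (the term `F = 0` contributes only the element `0`). -/
def finiteTypeFun (σ : SemistarOperation D K) (E : Submodule D K) : Submodule D K where
  carrier := {x | ∃ F : Submodule D K, F.FG ∧ F ≤ E ∧ x ∈ σ F}
  zero_mem' := ⟨⊥, Submodule.fg_bot, bot_le, Submodule.zero_mem _⟩
  add_mem' := by
    rintro x y ⟨F, hF, hFE, hx⟩ ⟨G, hG, hGE, hy⟩
    exact ⟨F ⊔ G, hF.sup hG, sup_le hFE hGE,
      Submodule.add_mem _ (σ.mono' _ _ le_sup_left hx) (σ.mono' _ _ le_sup_right hy)⟩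
  smul_mem' := by
    rintro d x ⟨F, hF, hFE, hx⟩
    exact ⟨F, hF, hFE, Submodule.smul_mem _ d hx⟩

theorem finiteTypeFun_smul_le (σ : SemistarOperation D K) (x : K) (E : Submodule D K)
    (hx : x ≠ 0) : x • σ.finiteTypeFun E ≤ σ.finiteTypeFun (x • E) := by
  intro y hy
  obtain ⟨z, ⟨F, hF, hFE, hz⟩, rfl⟩ := hy
  refine ⟨x • F, hF.map _, Submodule.map_mono hFE, ?_⟩
  rw [σ.map_smul' x F hx]
  exact Submodule.smul_mem_pointwise_smul z x _ hz

/-- The finite-type semistar operation `⋆_f` associated with `⋆`. -/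
def finiteType (σ : SemistarOperation D K) : SemistarOperation D K where
  toFun := σ.finiteTypeFun
  map_bot' := by
    rw [eq_bot_iff]
    rintro x ⟨F, -, hF, hx⟩
    rw [le_bot_iff.mp hF, σ.map_bot'] at hx
    exact hx
  map_smul' := by
    intro x E hx
    refine le_antisymm ?_ (σ.finiteTypeFun_smul_le x E hx)
    have h := Submodule.map_mono (f := DistribSMul.toLinearMap D K x)
      (σ.finiteTypeFun_smul_le x⁻¹ (x • E) (inv_ne_zero hx))
    change x • (x⁻¹ • σ.finiteTypeFun (x • E)) ≤ x • σ.finiteTypeFun (x⁻¹ • (x • E)) at h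
    rwa [smul_smul, smul_smul, mul_inv_cancel₀ hx, inv_mul_cancel₀ hx, one_smul, one_smul] at h
  mono' := by
    rintro E F hEF x ⟨G, hG, hGE, hx⟩
    exact ⟨G, hG, hGE.trans hEF, hx⟩
  le_self' := by
    intro E x hx
    exact ⟨Submodule.span D {x}, Submodule.fg_span_singleton x,
      (Submodule.span_singleton_le_iff_mem x E).mpr hx,
      σ.le_self' _ (Submodule.mem_span_singleton_self x)⟩
  idem' := by
    intro E
    have key : ∀ F : Submodule D K, F.FG → F ≤ σ.finiteTypeFun E →
        ∃ G : Submodule D K, G.FG ∧ G ≤ E ∧ F ≤ σ G := by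
      intro F hF
      induction F, hF using Submodule.fg_induction with
      | singleton x =>
        intro h
        obtain ⟨G, hG, hGE, hx⟩ := h (Submodule.mem_span_singleton_self x)
        exact ⟨G, hG, hGE, (Submodule.span_singleton_le_iff_mem x _).mpr hx⟩
      | sup F₁ F₂ _ _ h₁ h₂ =>
        intro h
        obtain ⟨G₁, hG₁, hE₁, hF₁⟩ := h₁ (le_sup_left.trans h)
        obtain ⟨G₂, hG₂, hE₂, hF₂⟩ := h₂ (le_sup_right.trans h)
        exact ⟨G₁ ⊔ G₂, hG₁.sup hG₂, sup_le hE₁ hE₂,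
          sup_le (hF₁.trans (σ.mono' _ _ le_sup_left)) (hF₂.trans (σ.mono' _ _ le_sup_right))⟩
    refine le_antisymm ?_ ?_
    · rintro x ⟨F, hF, hFE, hx⟩
      obtain ⟨G, hG, hGE, hFG⟩ := key F hF hFE
      refine ⟨G, hG, hGE, ?_⟩
      rw [← σ.idem' G]
      exact σ.mono' _ _ hFG hx
    · intro x hx
      exact ⟨Submodule.span D {x}, Submodule.fg_span_singleton x,
        (Submodule.span_singleton_le_iff_mem x _).mpr hx,
        σ.le_self' _ (Submodule.mem_span_singleton_self x)⟩

/-- A quasi-`⋆`-ideal: a nonzero ideal `I` of `D` with `I^⋆ ∩ D = I`. -/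
def IsQuasiIdeal (σ : SemistarOperation D K) (I : Ideal D) : Prop :=
  I ≠ ⊥ ∧ (σ (coeSubmodule K I)).comap (Algebra.linearMap D K) = I

/-- A quasi-`⋆`-maximal ideal: a maximal element of the set of proper quasi-`⋆`-ideals. -/
def IsQuasiMaximal (σ : SemistarOperation D K) (M : Ideal D) : Prop :=
  Maximal (fun J : Ideal D => σ.IsQuasiIdeal J ∧ J ≠ ⊤) M

theorem IsQuasiMaximal.isPrime {σ : SemistarOperation D K} {P : Ideal D}
    (hP : σ.IsQuasiMaximal P) : P.IsPrime := by
  refine ⟨hP.prop.2, ?_⟩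
  intro a b hab
  by_contra hcon
  rw [not_or] at hcon
  obtain ⟨ha, hb⟩ := hcon
  have hb0 : algebraMap D K b ≠ 0 := by
    intro h
    have h0 : b = 0 := (map_eq_zero_iff _ (IsFractionRing.injective D K)).mp h
    exact hb (h0 ▸ P.zero_mem)
  set Q : Ideal D := P ⊔ Ideal.span {a} with hQ
  set J : Ideal D := (σ (coeSubmodule K Q)).comap (Algebra.linearMap D K) with hJ
  have hQJ : Q ≤ J := fun x hx =>
    σ.le_self' _ ((IsLocalization.mem_coeSubmodule K Q).mpr ⟨x, hx, rfl⟩)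
  have hPJ : P ≤ J := le_sup_left.trans hQJ
  have hJs : coeSubmodule K J ≤ σ (coeSubmodule K Q) := by
    intro x hx
    obtain ⟨y, hy, rfl⟩ := (IsLocalization.mem_coeSubmodule K J).mp hx
    exact hy
  have hJq : σ.IsQuasiIdeal J := by
    refine ⟨fun h => hP.prop.1.1 (le_bot_iff.mp (h ▸ hPJ)), le_antisymm ?_ ?_⟩
    · intro x hx
      have := σ.mono' _ _ hJs hx
      rw [σ.idem'] at this
      exact this
    · intro x hx
      exact σ.le_self' _ ((IsLocalization.mem_coeSubmodule K J).mpr ⟨x, hx, rfl⟩)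
  have haJ : a ∈ J := hQJ ((le_sup_right : Ideal.span {a} ≤ Q) (Ideal.mem_span_singleton_self a))
  have hJtop : J = ⊤ := by
    by_contra hne
    exact ha (hP.le_of_ge ⟨hJq, hne⟩ hPJ haJ)
  have h1 : algebraMap D K 1 ∈ σ (coeSubmodule K Q) := by
    have : (1 : D) ∈ J := hJtop ▸ Submodule.mem_top
    exact this
  have h2 : algebraMap D K b • coeSubmodule K Q ≤ coeSubmodule K P := by
    rintro _ ⟨y, hy, rfl⟩
    obtain ⟨q, hq, rfl⟩ := (IsLocalization.mem_coeSubmodule K Q).mp hy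
    refine (IsLocalization.mem_coeSubmodule K P).mpr ⟨b * q, ?_, ?_⟩
    · obtain ⟨p, hp, c, hc, rfl⟩ := Submodule.mem_sup.mp hq
      obtain ⟨d, rfl⟩ := Ideal.mem_span_singleton'.mp hc
      have e : b * (p + d * a) = b * p + d * (a * b) := by ring
      rw [e]
      exact P.add_mem (P.mul_mem_left _ hp) (P.mul_mem_left _ hab)
    · rw [map_mul]
      rfl
  have h3 : algebraMap D K b • algebraMap D K 1 ∈ σ (coeSubmodule K P) := by
    apply σ.mono' _ _ h2
    rw [σ.map_smul' _ _ hb0]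
    exact Submodule.smul_mem_pointwise_smul _ _ _ h1
  rw [map_one, smul_eq_mul, mul_one] at h3
  have h4 : b ∈ (σ (coeSubmodule K P)).comap (Algebra.linearMap D K) := h3
  rw [hP.prop.1.2] at h4
  exact hb h4

variable (K) in
/-- The localization `D_P` of `D` at a prime ideal `P`, as a subring of `K`. -/
noncomputable def locAt (P : Ideal D) (hP : P.IsPrime) : Subalgebra D K :=
  Localization.subalgebra.ofField K P.primeCompl P.primeCompl_le_nonZeroDivisors

/-- `Θ^⋆(P)`: the intersection of the localizations `D_M`, where `M` ranges over the
quasi-`⋆`-maximal ideals of `D` not containing `P` (it is `K` if there are none). -/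
noncomputable def theta (σ : SemistarOperation D K) (P : Ideal D) : Subalgebra D K :=
  ⨅ (M : Ideal D) (hM : σ.IsQuasiMaximal M) (_ : ¬ P ≤ M), locAt K M hM.isPrime

/-- A prime ideal `P` is `⋆`-sharp if `Θ^⋆(P) ⊈ D_P`. -/
def IsSharp (σ : SemistarOperation D K) (P : Ideal D) (hP : P.IsPrime) : Prop :=
  ¬ σ.theta P ≤ locAt K P hP

/-- `E` is `⋆`-idempotent if `E^⋆ = (E²)^⋆`. -/
def IsIdempotent (σ : SemistarOperation D K) (E : Submodule D K) : Prop :=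
  σ E = σ (E ^ 2)

/-- `D` is a Prüfer `⋆`-multiplication domain: `(F F⁻¹)^{⋆_f} = D^{⋆_f}` for every nonzero finitely
generated `D`-submodule `F` of `K`, where `F⁻¹ = (D : F)`. -/
def IsPSMD (σ : SemistarOperation D K) : Prop :=
  ∀ F : Submodule D K, F.FG → F ≠ ⊥ → σ.finiteType (F * (1 / F)) = σ.finiteType 1

variable (D K) in
open Classical in
/-- The `v`-operation `E ↦ E^v = (E⁻¹)⁻¹`, with `E⁻¹ = (D : E)`. -/
noncomputable def vOp : SemistarOperation D K where
  toFun E := if E = ⊥ then ⊥ else 1 / (1 / E)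
  map_bot' := if_pos rfl
  map_smul' := by
    have hinv : ∀ (x : K) (E : Submodule D K), x ≠ 0 → 1 / (x • E) = x⁻¹ • (1 / E) := by
      intro x E hx
      ext y
      rw [Submodule.mem_div_iff_forall_mul_mem]
      constructor
      · intro h
        have h' : x * y ∈ 1 / E := by
          rw [Submodule.mem_div_iff_forall_mul_mem]
          intro z hz
          have := h (x • z) (Submodule.smul_mem_pointwise_smul z x E hz)
          rwa [smul_eq_mul, mul_left_comm, ← mul_assoc] at this
        have := Submodule.smul_mem_pointwise_smul _ x⁻¹ _ h'
        rwa [smul_eq_mul, inv_mul_cancel_left₀ hx] at this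
      · rintro ⟨z, hz, rfl⟩ _ ⟨w, hw, rfl⟩
        have := (Submodule.mem_div_iff_forall_mul_mem.mp hz) w hw
        change (x⁻¹ * z) * (x * w) ∈ (1 : Submodule D K)
        have e : (x⁻¹ * z) * (x * w) = z * w := by field_simp
        rwa [e]
    intro x E hx
    have hbot : x • E = ⊥ ↔ E = ⊥ := by
      constructor
      · intro h
        rw [← one_smul K E, ← inv_mul_cancel₀ hx, ← smul_smul, h]
        exact Submodule.map_bot _
      · rintro rfl
        exact Submodule.map_bot _
    by_cases hE : E = ⊥
    · rw [if_pos (hbot.mpr hE), if_pos hE]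
      exact (Submodule.map_bot _).symm
    · rw [if_neg (fun h => hE (hbot.mp h)), if_neg hE, hinv x E hx,
        hinv x⁻¹ _ (inv_ne_zero hx), inv_inv]
  mono' := by
    intro E F hEF
    by_cases hE : E = ⊥
    · rw [if_pos hE]
      exact bot_le
    · have hF : F ≠ ⊥ := fun h => hE (le_bot_iff.mp (h ▸ hEF))
      rw [if_neg hE, if_neg hF]
      intro x hx
      rw [Submodule.mem_div_iff_forall_mul_mem] at hx ⊢
      intro y hy
      apply hx y
      rw [Submodule.mem_div_iff_forall_mul_mem] at hy ⊢
      exact fun z hz => hy z (hEF hz)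
  le_self' := by
    intro E
    by_cases hE : E = ⊥
    · rw [if_pos hE, hE]
    · rw [if_neg hE]
      intro x hx
      rw [Submodule.mem_div_iff_forall_mul_mem]
      intro y hy
      rw [mul_comm]
      exact (Submodule.mem_div_iff_forall_mul_mem.mp hy) x hx
  idem' := by
    intro E
    by_cases hE : E = ⊥
    · simp only [if_pos hE, if_true]
    · have hle : ∀ G : Submodule D K, G ≤ 1 / (1 / G) := by
        intro G x hx
        rw [Submodule.mem_div_iff_forall_mul_mem]
        intro y hy
        rw [mul_comm]
        exact (Submodule.mem_div_iff_forall_mul_mem.mp hy) x hx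
      have hE' : (1 / (1 / E) : Submodule D K) ≠ ⊥ := fun h => hE (le_bot_iff.mp (h ▸ hle E))
      rw [if_neg hE, if_neg hE']
      refine le_antisymm ?_ (hle _)
      intro x hx
      rw [Submodule.mem_div_iff_forall_mul_mem] at hx ⊢
      exact fun y hy => hx y (hle _ hy)

variable (D K) in
/-- The `t`-operation `t = v_f`. -/
noncomputable def tOp : SemistarOperation D K := (vOp D K).finiteType

variable (D K) in
/-- `D` is a P`v`MD: every nonzero finitely generated `F` is `t`-invertible,
`(F F⁻¹)^t = D`. -/
def IsPvMD : Prop :=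
  ∀ F : Submodule D K, F.FG → F ≠ ⊥ → tOp D K (F * (1 / F)) = 1

variable (K) in
/-- A `t`-ideal: a nonzero ideal `I` of `D` with `I^t = I`. -/
def IsTIdeal (I : Ideal D) : Prop :=
  I ≠ ⊥ ∧ tOp D K (coeSubmodule K I) = coeSubmodule K I

variable (K) in
/-- A maximal `t`-ideal: a maximal element of the set of proper `t`-ideals. -/
def IsMaximalTIdeal (M : Ideal D) : Prop :=
  Maximal (fun J : Ideal D => IsTIdeal K J ∧ J ≠ ⊤) M

theorem tOp_one_le : tOp D K 1 ≤ 1 := by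
  rintro x ⟨F, -, hF, hx⟩
  have h : x ∈ vOp D K 1 := (vOp D K).mono' _ _ hF hx
  change x ∈ (if (1 : Submodule D K) = ⊥ then ⊥ else 1 / (1 / 1)) at h
  split_ifs at h with h1
  · rw [h1]
    exact h
  · have h2 := (Submodule.mem_div_iff_forall_mul_mem.mp h) 1
      (Submodule.one_mem_div.mpr le_rfl)
    rwa [mul_one] at h2

theorem isTIdeal_iff (I : Ideal D) : IsTIdeal K I ↔ (tOp D K).IsQuasiIdeal I := by
  refine and_congr_right fun _ => ?_
  constructor
  · intro h
    rw [h]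
    exact Submodule.comap_map_eq_of_injective (IsFractionRing.injective D K) I
  · intro h
    refine le_antisymm ?_ ((tOp D K).le_self' _)
    intro x hx
    have hx1 : x ∈ (1 : Submodule D K) := by
      apply tOp_one_le
      refine (tOp D K).mono' _ _ ?_ hx
      rw [← IsLocalization.coeSubmodule_top]
      exact IsLocalization.coeSubmodule_mono K le_top
    obtain ⟨d, rfl⟩ := Submodule.mem_one.mp hx1
    refine (IsLocalization.mem_coeSubmodule K I).mpr ⟨d, ?_, rfl⟩
    rw [← h]
    exact hx

theorem isMaximalTIdeal_iff (M : Ideal D) :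
    IsMaximalTIdeal K M ↔ (tOp D K).IsQuasiMaximal M := by
  unfold IsMaximalTIdeal IsQuasiMaximal
  simp only [isTIdeal_iff]

theorem IsMaximalTIdeal.isPrime {M : Ideal D} (hM : IsMaximalTIdeal K M) : M.IsPrime :=
  ((isMaximalTIdeal_iff M).mp hM).isPrime

end SemistarOperation

/-- A prime ideal `P` is branched if there is a `P`-primary ideal distinct from `P`. -/
def Ideal.IsBranched {R : Type*} [CommRing R] (P : Ideal R) : Prop :=
  ∃ Q : Ideal R, Q.IsPrimary ∧ Q.radical = P ∧ Q ≠ P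

/-!
Let `M` be a branched quasi-`⋆_f`-maximal ideal of a P`⋆`MD. The localization `D_M` is a valuation
ring containing `D^⋆`. Hence, if `Q ≠ M` is `M`-primary and `a ∈ M ∖ Q`, then `Q ⊆ I` for
`I = aD_M ∩ D`. Suppose that `M` is not sharp. An element `x` of `(D^⋆ : I)` lies in `D_N` for each
quasi-`⋆_f`-maximal `N ≠ M`, because `I ⊈ N`; so `x ∈ Θ(M) ⊆ D_M`, and therefore
`x ∈ ⋂ D_N = D^⋆`. Thus `(D^⋆ : I) = D^⋆`, and `I` is `⋆_f`-idempotent by hypothesis. On the other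
hand `a²D_M` is `⋆_f`-closed, so that `a ∈ I^{⋆_f} = (I²)^{⋆_f} ⊆ a²D_M`, which is absurd since `a`
is not a unit of `D_M`.
-/

namespace SemistarOperation

variable {D K : Type*} [CommRing D] [IsDomain D] [Field K] [Algebra D K] [IsFractionRing D K]

section Closure

variable (σ : SemistarOperation D K)

theorem apply_le_of_le_apply {E F : Submodule D K} (h : E ≤ σ F) : σ E ≤ σ F :=
  (σ.mono' _ _ h).trans_eq (σ.idem' F)

theorem mul_apply_le (E F : Submodule D K) : E * σ F ≤ σ (E * F) := by
  refine Submodule.mul_le.mpr fun x hx y hy => ?_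
  rcases eq_or_ne x 0 with rfl | hx0
  · rw [zero_mul]
    exact Submodule.zero_mem _
  have hle : x • F ≤ E * F := by
    rintro _ ⟨z, hz, rfl⟩
    exact Submodule.mul_mem_mul hx hz
  have hxy : x * y ∈ x • σ F := Submodule.smul_mem_pointwise_smul y x _ hy
  rw [← σ.map_smul' x F hx0] at hxy
  exact σ.mono' _ _ hle hxy

theorem finiteType_apply_one : σ.finiteType 1 = σ 1 := by
  refine le_antisymm ?_ fun x hx => ⟨1, ?_, le_rfl, hx⟩
  · rintro x ⟨F, -, hF, hx⟩
    exact σ.mono' _ _ hF hx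
  · rw [Submodule.one_eq_span]
    exact Submodule.fg_span_singleton 1

theorem mem_finiteType_iSup_of_directed {ι : Type*} [Nonempty ι] {E : ι → Submodule D K}
    (hE : Directed (· ≤ ·) E) {x : K} :
    x ∈ σ.finiteType (⨆ i, E i) ↔ ∃ i, x ∈ σ.finiteType (E i) := by
  constructor
  · rintro ⟨F, hF, hFE, hx⟩
    obtain ⟨_, ⟨i, rfl⟩, hFi⟩ :=
      (CompleteLattice.isCompactElement_iff_le_of_directed_sSup_le _ F).mp
        ((Submodule.fg_iff_compact F).mp hF) _ (Set.range_nonempty E) hE.directedOn_range hFE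
    exact ⟨i, F, hF, hFi, hx⟩
  · rintro ⟨i, hx⟩
    exact σ.finiteType.mono' _ _ (le_iSup E i) hx

end Closure

section QuasiIdeal

theorem IsQuasiIdeal.algebraMap_mem_apply_iff {σ : SemistarOperation D K} {I : Ideal D}
    (hI : σ.IsQuasiIdeal I) {d : D} : algebraMap D K d ∈ σ (coeSubmodule K I) ↔ d ∈ I :=
  SetLike.ext_iff.mp hI.2 d

theorem IsQuasiIdeal.one_mem_apply_iff {σ : SemistarOperation D K} {I : Ideal D}
    (hI : σ.IsQuasiIdeal I) : (1 : K) ∈ σ (coeSubmodule K I) ↔ I = ⊤ := by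
  rw [← map_one (algebraMap D K), hI.algebraMap_mem_apply_iff, Ideal.eq_top_iff_one]

theorem IsQuasiIdeal.mem_of_algebraMap_eq_mul {σ : SemistarOperation D K} {I : Ideal D}
    (hI : σ.IsQuasiIdeal I) {d s : D} (hd : d ∈ I) {y : K} (hy : y ∈ σ 1)
    (hs : algebraMap D K s = algebraMap D K d * y) : s ∈ I := by
  rw [← hI.algebraMap_mem_apply_iff, hs, ← mul_one (coeSubmodule K I)]
  exact σ.mul_apply_le _ _ (Submodule.mul_mem_mul ⟨d, hd, rfl⟩ hy)

theorem isQuasiMaximal_of_maximal_one_notMem {σ : SemistarOperation D K} {M : Ideal D}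
    (hM0 : M ≠ ⊥) (hM : Maximal (fun J : Ideal D => (1 : K) ∉ σ (coeSubmodule K J)) M) :
    σ.IsQuasiMaximal M := by
  set N : Ideal D := (σ (coeSubmodule K M)).comap (Algebra.linearMap D K)
  have hMN : M ≤ N := fun d hd =>
    σ.le_self' _ ((IsLocalization.mem_coeSubmodule K M).mpr ⟨d, hd, rfl⟩)
  have hNM : N ≤ M :=
    hM.le_of_ge (fun h => hM.prop (σ.apply_le_of_le_apply (Submodule.map_comap_le _ _) h)) hMN
  have hMquasi : σ.IsQuasiIdeal M := ⟨hM0, le_antisymm hNM hMN⟩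
  exact ⟨⟨hMquasi, fun h => hM.prop (hMquasi.one_mem_apply_iff.mpr h)⟩,
    fun J hJ hMJ => hM.le_of_ge (fun h => hJ.2 (hJ.1.one_mem_apply_iff.mp h)) hMJ⟩

theorem exists_le_isQuasiMaximal (σ : SemistarOperation D K) {I : Ideal D} (hI : I ≠ ⊥)
    (h1 : (1 : K) ∉ σ.finiteType (coeSubmodule K I)) :
    ∃ M, σ.finiteType.IsQuasiMaximal M ∧ I ≤ M := by
  have hchain : ∀ c ⊆ {J : Ideal D | (1 : K) ∉ σ.finiteType (coeSubmodule K J)},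
      IsChain (· ≤ ·) c → c.Nonempty → (1 : K) ∉ σ.finiteType (coeSubmodule K (sSup c)) := by
    intro c hc hchain hne
    have : Nonempty c := hne.to_subtype
    have hdir : Directed (· ≤ ·) fun L : c => coeSubmodule K L.1 :=
      hchain.directedOn.directed_val.mono_comp _ fun _ _ => IsLocalization.coeSubmodule_mono K
    have hsup : coeSubmodule K (sSup c) = ⨆ L : c, coeSubmodule K L.1 := by
      rw [sSup_eq_iSup']
      exact Submodule.map_iSup _ _
    rw [hsup, σ.mem_finiteType_iSup_of_directed hdir]
    rintro ⟨L, hL⟩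
    exact hc L.2 hL
  obtain ⟨M, hIM, hM⟩ := zorn_le_nonempty₀ _
    (fun c hc hc' J hJ => ⟨sSup c, hchain c hc hc' ⟨J, hJ⟩, fun _ => le_sSup⟩) I h1
  exact ⟨M, isQuasiMaximal_of_maximal_one_notMem (fun h => hI (le_bot_iff.mp (h ▸ hIM))) hM, hIM⟩

end QuasiIdeal

section Localization

variable {P : Ideal D} {hP : P.IsPrime}

theorem mem_locAt_iff {x : K} : x ∈ locAt K P hP ↔ ∃ s ∉ P, s • x ∈ (1 : Submodule D K) := by
  have hne : ∀ s ∉ P, algebraMap D K s ≠ 0 := fun s hs h =>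
    hs ((FaithfulSMul.algebraMap_eq_zero_iff D K).mp h ▸ P.zero_mem)
  constructor
  · rintro ⟨d, s, hs, rfl⟩
    refine ⟨s, hs, Submodule.mem_one.mpr ⟨d, ?_⟩⟩
    rw [Algebra.smul_def, mul_left_comm, mul_inv_cancel₀ (hne s hs), mul_one]
  · rintro ⟨s, hs, hsx⟩
    obtain ⟨d, hd⟩ := Submodule.mem_one.mp hsx
    refine ⟨d, s, hs, ?_⟩
    rw [hd, Algebra.smul_def, mul_comm, inv_mul_cancel_left₀ (hne s hs)]

theorem notMem_locAt_iff_colon_le {x : K} :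
    x ∉ locAt K P hP ↔ (1 : Submodule D K).colon {x} ≤ P := by
  rw [← not_iff_not, not_not, mem_locAt_iff, SetLike.not_le_iff_exists]
  simp only [Submodule.mem_colon_singleton, and_comm]

theorem mem_locAt_of_smul_mem {s : D} {x : K} (hs : s ∉ P) (h : s • x ∈ locAt K P hP) :
    x ∈ locAt K P hP := by
  obtain ⟨t, ht, htx⟩ := mem_locAt_iff.mp h
  exact mem_locAt_iff.mpr ⟨t * s, hP.mul_notMem ht hs, by rwa [mul_smul]⟩

theorem inv_algebraMap_notMem_locAt {a : D} (ha : a ∈ P) (ha0 : a ≠ 0) :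
    (algebraMap D K a)⁻¹ ∉ locAt K P hP := by
  rw [notMem_locAt_iff_colon_le]
  intro s hs
  obtain ⟨d, hd⟩ := Submodule.mem_one.mp (Submodule.mem_colon_singleton.mp hs)
  have ha0' : algebraMap D K a ≠ 0 := (FaithfulSMul.algebraMap_eq_zero_iff D K).not.mpr ha0
  have hsda : s = d * a := by
    apply IsFractionRing.injective D K
    rw [map_mul, hd, Algebra.smul_def, inv_mul_cancel_right₀ ha0']
  exact hsda ▸ P.mul_mem_left d ha

theorem exists_smul_le_one_of_fg {F : Submodule D K} (hF : F.FG)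
    (hFP : F ≤ (locAt K P hP).toSubmodule) : ∃ s ∉ P, s • F ≤ 1 := by
  induction F, hF using Submodule.fg_induction with
  | singleton x =>
    obtain ⟨s, hs, hsx⟩ := mem_locAt_iff.mp (hFP (Submodule.mem_span_singleton_self x))
    refine ⟨s, hs, ?_⟩
    rwa [Submodule.smul_span, Set.smul_set_singleton, Submodule.span_singleton_le_iff_mem]
  | sup F₁ F₂ _ _ h₁ h₂ =>
    obtain ⟨s, hs, hsF⟩ := h₁ (le_sup_left.trans hFP)
    obtain ⟨t, ht, htF⟩ := h₂ (le_sup_right.trans hFP)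
    refine ⟨s * t, hP.mul_notMem hs ht, ?_⟩
    rw [Submodule.smul_sup']
    refine sup_le ?_ ?_
    · rw [mul_comm, mul_smul]
      exact (smul_mono_right t hsF).trans (Submodule.smul_le_self_of_tower t 1)
    · rw [mul_smul]
      exact (smul_mono_right s htF).trans (Submodule.smul_le_self_of_tower s 1)

theorem finiteType_locAt (σ : SemistarOperation D K) (h1 : σ 1 ≤ (locAt K P hP).toSubmodule) :
    σ.finiteType (locAt K P hP).toSubmodule = (locAt K P hP).toSubmodule := by
  refine le_antisymm ?_ (σ.finiteType.le_self' _)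
  rintro x ⟨F, hF, hFP, hx⟩
  obtain ⟨s, hs, hsF⟩ := exists_smul_le_one_of_fg hF hFP
  have hspan : Submodule.span D {algebraMap D K s} * F ≤ 1 := by
    rw [Submodule.span_singleton_mul]
    rintro _ ⟨y, hy, rfl⟩
    exact hsF ⟨y, hy, (algebraMap_smul K s y).symm⟩
  have hsx : algebraMap D K s * x ∈ σ 1 :=
    σ.mono' _ _ hspan <| σ.mul_apply_le _ _ <|
      Submodule.mul_mem_mul (Submodule.mem_span_singleton_self _) hx
  rw [← Algebra.smul_def] at hsx
  exact mem_locAt_of_smul_mem hs (h1 hsx)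

theorem not_isIdempotent_of_le_smul_locAt {σ : SemistarOperation D K}
    (h1 : σ 1 ≤ (locAt K P hP).toSubmodule) {E : Submodule D K} {a : K} (haE : a ∈ E)
    (hE : E ≤ a • (locAt K P hP).toSubmodule) (ha : a⁻¹ ∉ locAt K P hP) :
    ¬ σ.finiteType.IsIdempotent E := by
  intro hidem
  have ha0 : a ≠ 0 := by
    rintro rfl
    rw [inv_zero] at ha
    exact ha (zero_mem _)
  have hE2 : E ^ 2 ≤ (a * a) • (locAt K P hP).toSubmodule := by
    rw [pow_two, Submodule.mul_le]
    rintro _ hx _ hy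
    obtain ⟨u, hu, rfl⟩ := hE hx
    obtain ⟨v, hv, rfl⟩ := hE hy
    exact ⟨u * v, (locAt K P hP).mul_mem hu hv, (mul_mul_mul_comm a u a v).symm⟩
  have haa : a ∈ (a * a) • (locAt K P hP).toSubmodule := by
    rw [← finiteType_locAt σ h1, ← σ.finiteType.map_smul' _ _ (mul_ne_zero ha0 ha0)]
    apply σ.finiteType.mono' _ _ hE2
    rw [← hidem]
    exact σ.finiteType.le_self' _ haE
  obtain ⟨u, hu, hau⟩ := haa
  have huinv : u = a⁻¹ := by
    refine eq_inv_of_mul_eq_one_right (mul_left_cancel₀ ha0 ?_)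
    rw [← mul_assoc, mul_one]
    exact hau
  exact ha (huinv ▸ hu)

theorem coeSubmodule_le_smul_locAt_of_isPrimary
    (hval : ∀ x : K, x ∈ locAt K P hP ∨ x⁻¹ ∈ locAt K P hP) {Q : Ideal D} (hQ : Q.IsPrimary)
    (hQP : Q.radical = P) {a : D} (ha : a ∉ Q) :
    coeSubmodule K Q ≤ algebraMap D K a • (locAt K P hP).toSubmodule := by
  have ha0 : algebraMap D K a ≠ 0 := fun h =>
    ha ((FaithfulSMul.algebraMap_eq_zero_iff D K).mp h ▸ Q.zero_mem)
  rintro _ ⟨q, hq, rfl⟩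
  rw [Submodule.mem_smul_iff_inv_mul_mem ha0, Algebra.linearMap_apply]
  rcases eq_or_ne q 0 with rfl | hq0
  · rw [map_zero, mul_zero]
    exact zero_mem _
  refine (hval _).resolve_right fun hinv => ?_
  obtain ⟨s, hs, hsinv⟩ := mem_locAt_iff.mp hinv
  obtain ⟨d, hd⟩ := Submodule.mem_one.mp hsinv
  have hq0' : algebraMap D K q ≠ 0 := (FaithfulSMul.algebraMap_eq_zero_iff D K).not.mpr hq0
  have hasdq : a * s = d * q := by
    apply IsFractionRing.injective D K
    rw [map_mul, map_mul, hd, Algebra.smul_def]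
    field_simp
  have hasQ : a * s ∈ Q := hasdq ▸ Q.mul_mem_left d hq
  exact ((Ideal.isPrimary_iff.mp hQ).2 hasQ).elim ha (hQP ▸ hs)

end Localization

section IntersectionOfLocalizations

variable {σ : SemistarOperation D K} {M : Ideal D}

theorem mem_apply_one_of_forall_mem_locAt {x : K}
    (hx : ∀ (N : Ideal D) (hN : σ.finiteType.IsQuasiMaximal N), x ∈ locAt K N hN.isPrime) :
    x ∈ σ 1 := by
  set J : Ideal D := (1 : Submodule D K).colon {x}
  have hJ0 : J ≠ ⊥ := by
    obtain ⟨⟨c, hc⟩, d, hd⟩ := IsLocalization.exists_integer_multiple (nonZeroDivisors D) x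
    have hcJ : c ∈ J := Submodule.mem_colon_singleton.mpr (Submodule.mem_one.mpr ⟨d, hd⟩)
    exact fun h => nonZeroDivisors.ne_zero hc (by rwa [h] at hcJ)
  have h1 : (1 : K) ∈ σ.finiteType (coeSubmodule K J) := by
    by_contra h1
    obtain ⟨N, hN, hJN⟩ := σ.exists_le_isQuasiMaximal hJ0 h1
    exact notMem_locAt_iff_colon_le.mpr hJN (hx N hN)
  have hle : Submodule.span D {x} * coeSubmodule K J ≤ 1 := by
    rw [Submodule.span_singleton_mul]
    rintro _ ⟨_, ⟨s, hs, rfl⟩, rfl⟩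
    have := Submodule.mem_colon_singleton.mp hs
    rwa [Algebra.smul_def, mul_comm] at this
  rw [← σ.finiteType_apply_one, ← mul_one x]
  exact σ.finiteType.mono' _ _ hle <| σ.finiteType.mul_apply_le _ _ <|
    Submodule.mul_mem_mul (Submodule.mem_span_singleton_self x) h1

theorem IsQuasiMaximal.mem_apply_one_of_mem_theta (hM : σ.finiteType.IsQuasiMaximal M) {x : K}
    (hθ : x ∈ σ.finiteType.theta M) (hxM : x ∈ locAt K M hM.isPrime) : x ∈ σ 1 := by
  refine mem_apply_one_of_forall_mem_locAt fun N hN => ?_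
  by_cases hMN : M ≤ N
  · obtain rfl : M = N := hM.eq_of_le hN.prop hMN
    exact hxM
  · simp only [theta, Algebra.mem_iInf] at hθ
    exact hθ N hN hMN

theorem mem_theta_of_mem_div {I : Ideal D}
    (h1 : ∀ (N : Ideal D) (hN : σ.IsQuasiMaximal N), σ 1 ≤ (locAt K N hN.isPrime).toSubmodule)
    (hMI : M ≤ I.radical) {x : K} (hx : x ∈ σ 1 / coeSubmodule K I) : x ∈ σ.theta M := by
  simp only [theta, Algebra.mem_iInf]
  intro N hN hMN
  have hIN : ¬ I ≤ N := fun h => hMN (hMI.trans (hN.isPrime.radical_le_iff.mpr h))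
  obtain ⟨q, hq, hqN⟩ := SetLike.not_le_iff_exists.mp hIN
  have hxq := Submodule.mem_div_iff_forall_mul_mem.mp hx _ ⟨q, hq, rfl⟩
  rw [Algebra.linearMap_apply, mul_comm, ← Algebra.smul_def] at hxq
  exact mem_locAt_of_smul_mem hqN (h1 N hN hxq)

end IntersectionOfLocalizations

namespace IsPSMD

variable {σ : SemistarOperation D K} {M : Ideal D}

theorem mem_or_inv_mem_locAt (h : σ.IsPSMD) (hM : σ.finiteType.IsQuasiMaximal M) (x : K) :
    x ∈ locAt K M hM.isPrime ∨ x⁻¹ ∈ locAt K M hM.isPrime := by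
  rcases eq_or_ne x 0 with rfl | hx0
  · exact Or.inl (zero_mem _)
  by_contra! hx
  simp only [notMem_locAt_iff_colon_le] at hx
  set F : Submodule D K := Submodule.span D {1, x}
  have h1F : 1 ∈ F := Submodule.subset_span (Set.mem_insert 1 {x})
  have hxF : x ∈ F := Submodule.subset_span (Set.mem_insert_of_mem 1 rfl)
  have hF0 : F ≠ ⊥ := fun h => one_ne_zero ((Submodule.eq_bot_iff F).mp h 1 h1F)
  have hle : F * (1 / F) ≤ coeSubmodule K M := by
    refine Submodule.mul_le.mpr fun f hf u hu => ?_
    have hmul := Submodule.mem_div_iff_forall_mul_mem.mp hu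
    obtain ⟨d, hd⟩ := Submodule.mem_one.mp (hmul 1 h1F)
    obtain ⟨e, he⟩ := Submodule.mem_one.mp (hmul x hxF)
    rw [mul_one] at hd
    subst hd
    have hdM : d ∈ M := hx.1 <| Submodule.mem_colon_singleton.mpr <|
      Submodule.mem_one.mpr ⟨e, by rw [he, Algebra.smul_def]⟩
    have heM : e ∈ M := hx.2 <| Submodule.mem_colon_singleton.mpr <|
      Submodule.mem_one.mpr ⟨d, by rw [Algebra.smul_def, he, mul_inv_cancel_right₀ hx0]⟩
    obtain ⟨r, t, rfl⟩ := Submodule.mem_span_pair.mp hf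
    refine (IsLocalization.mem_coeSubmodule K M).mpr
      ⟨r * d + t * e, M.add_mem (M.mul_mem_left r hdM) (M.mul_mem_left t heM), ?_⟩
    simp only [map_add, map_mul, he, Algebra.smul_def]
    ring
  have h1 : (1 : K) ∈ σ.finiteType (coeSubmodule K M) := by
    apply σ.finiteType.mono' _ _ hle
    rw [h F (Submodule.fg_span (Set.toFinite _)) hF0]
    exact σ.finiteType.le_self' _ (Submodule.one_le.mp le_rfl)
  exact hM.prop.2 (hM.prop.1.one_mem_apply_iff.mp h1)

theorem apply_one_le_locAt (h : σ.IsPSMD) (hM : σ.finiteType.IsQuasiMaximal M) :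
    σ 1 ≤ (locAt K M hM.isPrime).toSubmodule := by
  intro y hy
  by_contra hyM
  have hy0 : y ≠ 0 := by
    rintro rfl
    exact hyM (zero_mem _)
  obtain ⟨s, hs, hsy⟩ := mem_locAt_iff.mp ((h.mem_or_inv_mem_locAt hM y).resolve_left hyM)
  obtain ⟨d, hd⟩ := Submodule.mem_one.mp hsy
  have hsdy : algebraMap D K s = algebraMap D K d * y := by
    rw [hd, Algebra.smul_def, inv_mul_cancel_right₀ hy0]
  have hdM : d ∈ M := by
    refine notMem_locAt_iff_colon_le.mp hyM (Submodule.mem_colon_singleton.mpr ?_)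
    exact Submodule.mem_one.mpr ⟨s, by rw [hsdy, Algebra.smul_def]⟩
  rw [← σ.finiteType_apply_one] at hy
  exact hs (hM.prop.1.mem_of_algebraMap_eq_mul hdM hy hsdy)

theorem div_coeSubmodule_eq_of_not_isSharp (h : σ.IsPSMD) (hM : σ.finiteType.IsQuasiMaximal M)
    (hsharp : ¬ σ.finiteType.IsSharp M hM.isPrime) {I : Ideal D} (hMI : M ≤ I.radical) :
    σ 1 / coeSubmodule K I = σ 1 := by
  refine le_antisymm (fun x hx => ?_) fun x hx => ?_
  · have hθ : x ∈ σ.finiteType.theta M := by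
      rw [← σ.finiteType_apply_one] at hx
      refine mem_theta_of_mem_div (fun N hN => ?_) hMI hx
      rw [σ.finiteType_apply_one]
      exact h.apply_one_le_locAt hN
    exact hM.mem_apply_one_of_mem_theta hθ (not_not.mp hsharp hθ)
  · rw [Submodule.mem_div_iff_forall_mul_mem]
    rintro _ ⟨d, -, rfl⟩
    rw [Algebra.linearMap_apply, mul_comm, ← Algebra.smul_def]
    exact Submodule.smul_mem _ d hx

theorem isSharp_of_isBranched (h : σ.IsPSMD)
    (hidem : ∀ I : Ideal D, I ≠ ⊥ → σ 1 / coeSubmodule K I = σ 1 →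
      σ.finiteType.IsIdempotent (coeSubmodule K I))
    (hM : σ.finiteType.IsQuasiMaximal M) (hbranched : M.IsBranched) :
    σ.finiteType.IsSharp M hM.isPrime := by
  by_contra hsharp
  obtain ⟨Q, hQ, hQM, hQne⟩ := hbranched
  obtain ⟨a, haM, haQ⟩ := SetLike.exists_of_lt (lt_of_le_of_ne (hQM ▸ Q.le_radical) hQne)
  have ha0 : a ≠ 0 := fun h => haQ (h ▸ Q.zero_mem)
  set aD_M : Submodule D K := algebraMap D K a • (locAt K M hM.isPrime).toSubmodule
  set I : Ideal D := aD_M.comap (Algebra.linearMap D K)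
  have haI : a ∈ I := ⟨1, (locAt K M hM.isPrime).one_mem, mul_one _⟩
  have hQI : Q ≤ I := Submodule.map_le_iff_le_comap.mp <|
    coeSubmodule_le_smul_locAt_of_isPrimary (h.mem_or_inv_mem_locAt hM) hQ hQM haQ
  have hIdiv : σ 1 / coeSubmodule K I = σ 1 :=
    h.div_coeSubmodule_eq_of_not_isSharp hM hsharp (hQM ▸ Ideal.radical_mono hQI)
  have hI0 : I ≠ ⊥ := Submodule.ne_bot_iff I |>.mpr ⟨a, haI, ha0⟩
  exact not_isIdempotent_of_le_smul_locAt (h.apply_one_le_locAt hM)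
    ((IsLocalization.mem_coeSubmodule K I).mpr ⟨a, haI, rfl⟩) (Submodule.map_comap_le _ _)
    (inv_algebraMap_notMem_locAt haM ha0) (hidem I hI0 hIdiv)

end IsPSMD

theorem tOp_one : tOp D K 1 = 1 := le_antisymm tOp_one_le ((tOp D K).le_self' 1)

theorem vOp_one : vOp D K 1 = 1 := (vOp D K).finiteType_apply_one.symm.trans tOp_one

theorem IsPvMD.isPSMD (h : IsPvMD D K) : (vOp D K).IsPSMD :=
  fun F hF hF0 => (h F hF hF0).trans tOp_one.symm

end SemistarOperation

theorem mainTheorem9 {D K : Type*} [CommRing D] [IsDomain D] [Field K] [Algebra D K]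
    [IsFractionRing D K] :
    (∀ σ : SemistarOperation D K, σ.IsPSMD →
      (∀ I : Ideal D, I ≠ ⊥ → σ 1 / coeSubmodule K I = σ 1 →
        σ.finiteType.IsIdempotent (coeSubmodule K I)) →
      ∀ (M : Ideal D) (hM : σ.finiteType.IsQuasiMaximal M), M.IsBranched →
        σ.finiteType.IsSharp M hM.isPrime) ∧
    (SemistarOperation.IsPvMD D K →
      (∀ I : Ideal D, I ≠ ⊥ → (1 : Submodule D K) / coeSubmodule K I = 1 →
        (SemistarOperation.tOp D K).IsIdempotent (coeSubmodule K I)) →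
      ∀ (M : Ideal D) (hM : SemistarOperation.IsMaximalTIdeal K M), M.IsBranched →
        (SemistarOperation.tOp D K).IsSharp M hM.isPrime) := by
  refine ⟨fun σ h hidem M hM => h.isSharp_of_isBranched hidem hM, fun h hidem M hM => ?_⟩
  refine h.isPSMD.isSharp_of_isBranched (fun I hI hIdiv => hidem I hI ?_)
    ((SemistarOperation.isMaximalTIdeal_iff M).mp hM)
  rwa [SemistarOperation.vOp_one] at hIdiv
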